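/- Let $n,m\ge 0$ be integers. For integers $j,k\ge -1$ let $\mathcal P_{j,k}$ be the complex span of the monomials $z^sw^t$ with $0\le s\le j$, $0\le t\le k$ (so $\mathcal P_{j,k}=\{0\}$ if $j=-1$ or $k=-1$), and for $j,k\ge0$ let $\mathcal L_{j,k}$ be the complex span of the $z^sw^t$ with $|s|\le j$, $|t|\le k$. Let $\mathcal T:\mathcal L_{n,m}\to\mathbb C$ be a positive linear form, i.e. a linear form with $\mathcal T\big(f(z,w)\bar f(1/z,1/w)\big)>0$ for all nonzero $f\in\mathcal P_{n,m}$, where $\bar f(z,w)=\overline{f(\bar z,\bar w)}$. Let $\mathcal H$ be the finite-dimensional Hilbert space $\mathcal P_{n,m}$ with inner product $\langle f,g\rangle=\mathcal T\big(f(z,w)\bar g(1/z,1/w)\big)$; below, $\perp$, $\oplus$, $\ominus$, adjoints and the orthogonal projections $P_{\mathcal M}$ onto subspaces $\mathcal M\subset\mathcal H$ refer to this inner product. For $k\le n$, $l\le m$ put $$\mathcal E^1_{k,l}=\mathcal P_{k,l}\ominus w\mathcal P_{k,l-1},\qquad \mathcal E^2_{k,l}=\mathcal P_{k,l}\ominus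 z\mathcal P_{k-1,l},\qquad \mathcal F^2_{k,l}=\mathcal P_{k,l}\ominus \mathcal P_{k-1,l}$$ whenever these are defined, with $\mathcal E^1_{-1,m}=\mathcal E^2_{n,-1}=\mathcal F^2_{n,-1}=\{0\}$. With $M_z$ denoting multiplication by $z$, define $$A=P_{w\mathcal E^2_{n,m-1}}M_z:\mathcal E^1_{n-1,m}\to w\mathcal E^2_{n,m-1},\quad B=P_{\mathcal E^1_{n-1,m}}: w\mathcal F^2_{n,m-1}\to\mathcal E^1_{n-1,m},\quad T=P_{\mathcal E^1_{n-1,m}}M_z:\mathcal E^1_{n-1,m}\to\mathcal E^1_{n-1,m}.$$ A pair $(\mathcal K_1,\mathcal K_2)$ of subspaces of $\mathcal H$ is called a split-shift pair if (1) $\mathcal E^1_{n-1,m}=\mathcal K_1\oplus\mathcal K_2$ (orthogonal direct sum), (2) $\mathcal K_1\perp z\mathcal K_2$, and (3) $\mathcal K_1\subset\mathcal E^1_{n,m}$ and $z\mathcal K_2\subset\mathcal E^1_{n,m}$. **Theorem.** Assume that the matrix condition holds: $AT^jB=0$ for $j=0,1,\dots,n-1$. Let $$\mathcal B=\operatorname{span}\{T^jBf: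 f\in w\mathcal F^2_{n,m-1},\ j=0,1,\dots\},\qquad \mathcal A=\operatorname{span}\{(T^*)^jA^*f: f\in w\mathcal E^2_{n,m-1},\ j=0,1,\dots\}.$$ Then $(\mathcal E^1_{n-1,m}\ominus\mathcal B,\ \mathcal B)$ and $(\mathcal A,\ \mathcal E^1_{n-1,m}\ominus\mathcal A)$ are both split-shift pairs. Moreover, every split-shift pair $(\mathcal K_1',\mathcal K_2')$ satisfies $\mathcal A\subset\mathcal K_1'$ and $\mathcal B\subset\mathcal K_2'$. -/

import Mathlib

open scoped ComplexOrder

noncomputable section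

namespace SplitShift

/-- The ring `ℂ[z, z⁻¹, w, w⁻¹]` of Laurent polynomials in two variables;
the monomial `z ^ s * w ^ t` is the basis element with exponent `(s, t)`. -/
abbrev Laurent : Type := AddMonoidAlgebra ℂ (ℤ × ℤ)

/-- The monomial `z ^ s * w ^ t`. -/
def mono (s t : ℤ) : Laurent := AddMonoidAlgebra.single (s, t) 1

/-- The variable `z`. -/
def varZ : Laurent := mono 1 0

/-- The variable `w`. -/
def varW : Laurent := mono 0 1

/-- The Laurent polynomials `∑ c_{s,t} z^s w^t` with `-j ≤ s ≤ j`, `-k ≤ t ≤ k`. -/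
def lSpace (j k : ℤ) : Submodule ℂ Laurent :=
  Submodule.span ℂ {f | ∃ s t : ℤ, -j ≤ s ∧ s ≤ j ∧ -k ≤ t ∧ t ≤ k ∧ f = mono s t}

/-- The polynomials `∑ c_{s,t} z^s w^t` with `0 ≤ s ≤ j`, `0 ≤ t ≤ k`
(the zero space if `j` or `k` is negative). -/
def pSpace (j k : ℤ) : Submodule ℂ Laurent :=
  Submodule.span ℂ {f | ∃ s t : ℤ, 0 ≤ s ∧ s ≤ j ∧ 0 ≤ t ∧ t ≤ k ∧ f = mono s t}

/-- The map `f(z, w) ↦ f̄(1/z, 1/w)`, where `f̄` has the conjugated coefficients: it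
conjugates the coefficients and negates the exponents. -/
def conjInv : Laurent →+* Laurent :=
  (AddMonoidAlgebra.mapDomainRingHom ℂ (negAddMonoidHom : ℤ × ℤ →+ ℤ × ℤ)).comp
    (AddMonoidAlgebra.mapRingHom (ℤ × ℤ) (starRingEnd ℂ))

theorem conjInv_single (a : ℤ × ℤ) (c : ℂ) :
    conjInv (AddMonoidAlgebra.single a c) = AddMonoidAlgebra.single (-a) (starRingEnd ℂ c) := by
  simp [conjInv]

theorem conjInv_mono (s t : ℤ) : conjInv (mono s t) = mono (-s) (-t) := by
  simp [mono, conjInv_single]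

theorem conjInv_smul (c : ℂ) (f : Laurent) : conjInv (c • f) = starRingEnd ℂ c • conjInv f := by
  have h : ∀ (d : ℂ) (g : Laurent), d • g = AddMonoidAlgebra.single 0 d * g := by
    intro d g
    ext x
    simp
  rw [h, map_mul, conjInv_single, neg_zero, ← h]

theorem mono_mul (s t s' t' : ℤ) : mono s t * mono s' t' = mono (s + s') (t + t') := by
  simp [mono, AddMonoidAlgebra.single_mul_single]

theorem mul_conjInv_mem {j k : ℤ} {f g : Laurent} (hf : f ∈ pSpace j k) (hg : g ∈ pSpace j k) :
    f * conjInv g ∈ lSpace j k := by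
  induction hf using Submodule.span_induction with
  | zero => simp
  | add x y _ _ hx hy => rw [add_mul]; exact add_mem hx hy
  | smul c x _ hx => rw [smul_mul_assoc]; exact Submodule.smul_mem _ c hx
  | mem x hx =>
    obtain ⟨s, t, h1, h2, h3, h4, rfl⟩ := hx
    induction hg using Submodule.span_induction with
    | zero => simp
    | add x y _ _ hx hy => rw [map_add, mul_add]; exact add_mem hx hy
    | smul c x _ hx =>
      rw [conjInv_smul, mul_smul_comm]
      exact Submodule.smul_mem _ _ hx
    | mem y hy =>
      obtain ⟨s', t', h1', h2', h3', h4', rfl⟩ := hy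
      rw [conjInv_mono, mono_mul]
      exact Submodule.subset_span ⟨_, _, by omega, by omega, by omega, by omega, rfl⟩

theorem varZ_mul_mem {j k : ℤ} {f : Laurent} (hf : f ∈ pSpace (j - 1) k) :
    varZ * f ∈ pSpace j k := by
  induction hf using Submodule.span_induction with
  | zero => simp
  | add x y _ _ hx hy => rw [mul_add]; exact add_mem hx hy
  | smul c x _ hx => rw [mul_smul_comm]; exact Submodule.smul_mem _ c hx
  | mem x hx =>
    obtain ⟨s, t, h1, h2, h3, h4, rfl⟩ := hx
    rw [varZ, mono_mul]
    exact Submodule.subset_span ⟨_, _, by omega, by omega, by omega, by omega, rfl⟩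

/-- A positive linear form `𝒯` on the Laurent polynomials of bidegree at most `(n, m)`:
`𝒯(f(z,w) f̄(1/z,1/w)) > 0` (a positive real number) for every nonzero polynomial `f` of
bidegree at most `(n, m)`. -/
structure PositiveForm (n m : ℕ) where
  /-- The underlying linear form. -/
  form : lSpace n m →ₗ[ℂ] ℂ
  /-- Positivity. -/
  pos : ∀ f : pSpace n m, f ≠ 0 → 0 < form ⟨f * conjInv f, mul_conjInv_mem f.2 f.2⟩

variable {n m : ℕ}

/-- `⟨f, g⟩ = 𝒯(f(z,w) ḡ(1/z,1/w))`, linear in the first argument. -/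
def PositiveForm.ip (𝒯 : PositiveForm n m) (f g : pSpace n m) : ℂ :=
  𝒯.form ⟨f * conjInv g, mul_conjInv_mem f.2 g.2⟩

theorem PositiveForm.ip_add_left (𝒯 : PositiveForm n m) (f f' g : pSpace n m) :
    𝒯.ip (f + f') g = 𝒯.ip f g + 𝒯.ip f' g := by
  unfold PositiveForm.ip
  rw [← map_add]
  congr 1
  ext1
  simp [add_mul]

theorem PositiveForm.ip_add_right (𝒯 : PositiveForm n m) (f g g' : pSpace n m) :
    𝒯.ip f (g + g') = 𝒯.ip f g + 𝒯.ip f g' := by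
  unfold PositiveForm.ip
  rw [← map_add]
  congr 1
  ext1
  simp [mul_add]

theorem PositiveForm.ip_smul_left (𝒯 : PositiveForm n m) (c : ℂ) (f g : pSpace n m) :
    𝒯.ip (c • f) g = c * 𝒯.ip f g := by
  unfold PositiveForm.ip
  rw [← smul_eq_mul (a := c), ← map_smul]
  congr 1
  ext1
  simp

theorem PositiveForm.ip_smul_right (𝒯 : PositiveForm n m) (c : ℂ) (f g : pSpace n m) :
    𝒯.ip f (c • g) = starRingEnd ℂ c * 𝒯.ip f g := by
  unfold PositiveForm.ip
  rw [← smul_eq_mul (a := starRingEnd ℂ c), ← map_smul]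
  congr 1
  ext1
  simp [conjInv_smul]

theorem PositiveForm.ip_self_nonneg (𝒯 : PositiveForm n m) (f : pSpace n m) :
    0 ≤ 𝒯.ip f f := by
  by_cases hf : f = 0
  · subst hf
    have := 𝒯.ip_smul_left 0 0 0
    simp at this
    simp [this]
  · exact (𝒯.pos f hf).le

theorem PositiveForm.ip_conj_symm (𝒯 : PositiveForm n m) (f g : pSpace n m) :
    starRingEnd ℂ (𝒯.ip f g) = 𝒯.ip g f := by
  have im : ∀ h, (𝒯.ip h h).im = 0 := fun h =>
    (Complex.nonneg_iff.1 (𝒯.ip_self_nonneg h)).2.symm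
  have h1 := im (f + g)
  have h2 := im (f + Complex.I • g)
  simp only [ip_add_left, ip_add_right, ip_smul_left, ip_smul_right, Complex.add_im,
    Complex.add_re, Complex.mul_im, Complex.mul_re, Complex.conj_I, Complex.neg_re, Complex.neg_im,
    Complex.I_re, Complex.I_im, im f, im g] at h1 h2
  apply Complex.ext <;> simp only [Complex.conj_re, Complex.conj_im] <;> linarith

/-- The finite-dimensional Hilbert space `ℋ`: the polynomials of bidegree at most `(n, m)` with
the inner product given by `𝒯`. -/
def Hilb (_𝒯 : PositiveForm n m) : Type := pSpace n m

section
variable (𝒯 : PositiveForm n m)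

instance : AddCommGroup (Hilb 𝒯) := inferInstanceAs (AddCommGroup (pSpace n m))

instance : Module ℂ (Hilb 𝒯) := inferInstanceAs (Module ℂ (pSpace n m))

/-- Mathlib's inner products are linear in the second argument, so the arguments of
`PositiveForm.ip` are swapped here. -/
instance instCore : InnerProductSpace.Core ℂ (Hilb 𝒯) where
  inner f g := 𝒯.ip g f
  conj_inner_symm f g := 𝒯.ip_conj_symm f g
  re_inner_nonneg f := (Complex.nonneg_iff.1 (𝒯.ip_self_nonneg f)).1
  add_left f g h := 𝒯.ip_add_right h f g
  smul_left f g c := 𝒯.ip_smul_right c g f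
  definite f hf := by
    by_contra h
    exact (𝒯.pos f h).ne' hf

instance : NormedAddCommGroup (Hilb 𝒯) :=
  @InnerProductSpace.Core.toNormedAddCommGroup ℂ (Hilb 𝒯) _ _ _ (instCore 𝒯)

instance : InnerProductSpace ℂ (Hilb 𝒯) :=
  InnerProductSpace.ofCore (instCore 𝒯).toCore

/-- The inclusion of `ℋ` into the Laurent polynomials. -/
def incl : Hilb 𝒯 →ₗ[ℂ] Laurent := (pSpace n m).subtype

theorem inner_def (f g : Hilb 𝒯) : inner ℂ f g = 𝒯.ip g f := rfl

instance : FiniteDimensional ℂ (Hilb 𝒯) := by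
  have hfin : {f | ∃ s t : ℤ, 0 ≤ s ∧ s ≤ (n : ℤ) ∧ 0 ≤ t ∧ t ≤ (m : ℤ) ∧ f = mono s t}.Finite := by
    refine (((Set.finite_Icc (0 : ℤ) n).prod (Set.finite_Icc (0 : ℤ) m)).image
      (fun x => mono x.1 x.2)).subset ?_
    rintro f ⟨s, t, h1, h2, h3, h4, rfl⟩
    exact ⟨(s, t), ⟨⟨h1, h2⟩, ⟨h3, h4⟩⟩, rfl⟩
  have : FiniteDimensional ℂ (pSpace n m) := FiniteDimensional.span_of_finite ℂ hfin
  exact this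

variable {𝒯}

/-- The set of all `q * f` with `f ∈ V`, as a subspace of `ℋ`. In all uses below the products
`q * f` do lie in `ℋ`. -/
def mulSub (q : Laurent) (V : Submodule ℂ (Hilb 𝒯)) : Submodule ℂ (Hilb 𝒯) :=
  ((V.map (incl 𝒯)).map (LinearMap.mulLeft ℂ q)).comap (incl 𝒯)

/-- The orthogonal complement `V ⊖ W` of `W` in `V`. -/
def ominus (V W : Submodule ℂ (Hilb 𝒯)) : Submodule ℂ (Hilb 𝒯) := V ⊓ Wᗮ

variable (𝒯)

/-- The subspace of `ℋ` of polynomials of bidegree at most `(k, l)`. -/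
def polys (k l : ℤ) : Submodule ℂ (Hilb 𝒯) := (pSpace k l).comap (incl 𝒯)

/-- `ℰ¹_{k,l} = 𝒫_{k,l} ⊖ w 𝒫_{k,l-1}`. -/
def E1 (k l : ℤ) : Submodule ℂ (Hilb 𝒯) := ominus (polys 𝒯 k l) (mulSub varW (polys 𝒯 k (l - 1)))

/-- `ℰ²_{k,l} = 𝒫_{k,l} ⊖ z 𝒫_{k-1,l}`. -/
def E2 (k l : ℤ) : Submodule ℂ (Hilb 𝒯) := ominus (polys 𝒯 k l) (mulSub varZ (polys 𝒯 (k - 1) l))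

/-- `ℱ²_{k,l} = 𝒫_{k,l} ⊖ 𝒫_{k-1,l}`. -/
def F2 (k l : ℤ) : Submodule ℂ (Hilb 𝒯) := ominus (polys 𝒯 k l) (polys 𝒯 (k - 1) l)

/-- Multiplication by `z`, from the polynomials of bidegree at most `(n - 1, m)` to `ℋ`. -/
def Mz : polys 𝒯 (n - 1) m →ₗ[ℂ] Hilb 𝒯 :=
  LinearMap.codRestrict (pSpace n m)
    (LinearMap.mulLeft ℂ varZ ∘ₗ incl 𝒯 ∘ₗ (polys 𝒯 (n - 1) m).subtype)
    fun f => varZ_mul_mem f.2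

/-- The restriction of `M_z` to `ℰ¹_{n-1,m}`. -/
def MzE1 : E1 𝒯 (n - 1) m →ₗ[ℂ] Hilb 𝒯 := Mz 𝒯 ∘ₗ Submodule.inclusion inf_le_left

/-- `w ℰ²_{n,m-1}`. -/
def wE2 : Submodule ℂ (Hilb 𝒯) := mulSub varW (E2 𝒯 n (m - 1))

/-- `w ℱ²_{n,m-1}`. -/
def wF2 : Submodule ℂ (Hilb 𝒯) := mulSub varW (F2 𝒯 n (m - 1))

/-- `A = P M_z : ℰ¹_{n-1,m} → w ℰ²_{n,m-1}`, with `P` the orthogonal projection onto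
`w ℰ²_{n,m-1}`. -/
def opA : E1 𝒯 (n - 1) m →ₗ[ℂ] wE2 𝒯 :=
  (wE2 𝒯).orthogonalProjectionOnto.toLinearMap ∘ₗ MzE1 𝒯

/-- `B = P : w ℱ²_{n,m-1} → ℰ¹_{n-1,m}`, with `P` the orthogonal projection onto
`ℰ¹_{n-1,m}`. -/
def opB : wF2 𝒯 →ₗ[ℂ] E1 𝒯 (n - 1) m :=
  (E1 𝒯 (n - 1) m).orthogonalProjectionOnto.toLinearMap ∘ₗ (wF2 𝒯).subtype

/-- `T = P M_z : ℰ¹_{n-1,m} → ℰ¹_{n-1,m}`, with `P` the orthogonal projection onto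
`ℰ¹_{n-1,m}`. -/
def opT : E1 𝒯 (n - 1) m →ₗ[ℂ] E1 𝒯 (n - 1) m :=
  (E1 𝒯 (n - 1) m).orthogonalProjectionOnto.toLinearMap ∘ₗ MzE1 𝒯

/-- The matrix condition: `A T^j B = 0` for `j = 0, 1, …, n - 1`. -/
def MatrixCondition : Prop := ∀ j < n, opA 𝒯 ∘ₗ (opT 𝒯 ^ j) ∘ₗ opB 𝒯 = 0

/-- `(K₁, K₂)` satisfies the split-shift condition: `ℰ¹_{n-1,m} = K₁ ⊕ K₂` (orthogonal sum),
`K₁ ⟂ z K₂`, and `K₁`, `z K₂` are contained in `ℰ¹_{n,m}`. -/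
structure IsSplitShift (K₁ K₂ : Submodule ℂ (Hilb 𝒯)) : Prop where
  sup_eq : K₁ ⊔ K₂ = E1 𝒯 (n - 1) m
  ortho : K₁ ⟂ K₂
  ortho_shift : K₁ ⟂ mulSub varZ K₂
  left_le : K₁ ≤ E1 𝒯 n m
  shift_le : mulSub varZ K₂ ≤ E1 𝒯 n m

/-- `𝓑`, the span of all `T^j B f` with `f ∈ w ℱ²_{n,m-1}` and `j = 0, 1, …`. -/
def spaceB : Submodule ℂ (Hilb 𝒯) :=
  Submodule.span ℂ {h | ∃ (j : ℕ) (f : wF2 𝒯), h = ((opT 𝒯 ^ j) (opB 𝒯 f) : E1 𝒯 (n - 1) m)}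

/-- `𝓐`, the span of all `(T*)^j A* f` with `f ∈ w ℰ²_{n,m-1}` and `j = 0, 1, …`; the stars are
Hilbert space adjoints. -/
def spaceA : Submodule ℂ (Hilb 𝒯) :=
  Submodule.span ℂ {h | ∃ (j : ℕ) (f : wE2 𝒯),
    h = ((LinearMap.adjoint (opT 𝒯) ^ j) (LinearMap.adjoint (opA 𝒯) f) : E1 𝒯 (n - 1) m)}

end

end SplitShift

end

noncomputable section

namespace SplitShift

/-! The theorem reduces to linear algebra in ℰ¹_{n-1,m}. Once this space is an orthogonal sum K₁ ⊕
K₂, every other split-shift requirement is a condition on K₂ alone. Vectors of ℰ¹_{n-1,m} are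
already orthogonal to w𝒫_{n-1,m-1}, so K₁ ⊂ ℰ¹_{n,m} only asks K₁ ⟂ wℱ²_{n,m-1}, that is, ran B ⊂
K₂. Multiplication by z is isometric, so zK₂ is already orthogonal to zw𝒫_{n-1,m-1}, and zK₂ ⊂
ℰ¹_{n,m} only asks that A vanish on K₂. Finally K₁ ⟂ zK₂ means TK₂ ⊂ K₂. Hence (`isSplitShift_iff`)
the pairs correspond to the T-invariant K₂ with ran B ⊂ K₂ ⊂ ker A.

The smallest T-invariant subspace containing ran B is 𝓑, and the largest one inside ker A is the
complement of 𝓐 (`mem_ominus_spaceA_iff`); this bounds every pair. Both extremes are themselves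
admissible as soon as AT^jB = 0 for all j. The matrix condition gives this for j < n, and
Cayley–Hamilton (`pow_mem_span_pow_lt`) gives the rest because dim ℰ¹_{n-1,m} ≤ n (`finrank_E1_le`).
-/

theorem mem_ominus {n m : ℕ} {𝒯 : PositiveForm n m} {V W : Submodule ℂ (Hilb 𝒯)} {x : Hilb 𝒯} :
    x ∈ ominus V W ↔ x ∈ V ∧ ∀ y ∈ W, inner ℂ y x = 0 := by
  rw [ominus, Submodule.mem_inf, Submodule.mem_orthogonal]

/-! ### Degree bookkeeping for Laurent polynomials -/

theorem pSpace_mono {j k j' k' : ℤ} (hj : j ≤ j') (hk : k ≤ k') : pSpace j k ≤ pSpace j' k' := by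
  refine Submodule.span_mono ?_
  rintro f ⟨s, t, h1, h2, h3, h4, rfl⟩
  exact ⟨s, t, h1, h2.trans hj, h3, h4.trans hk, rfl⟩

theorem varW_mul_mem {j k : ℤ} {f : Laurent} (hf : f ∈ pSpace j (k - 1)) :
    varW * f ∈ pSpace j k := by
  induction hf using Submodule.span_induction with
  | zero => simp
  | add x y _ _ hx hy => rw [mul_add]; exact add_mem hx hy
  | smul c x _ hx => rw [mul_smul_comm]; exact Submodule.smul_mem _ c hx
  | mem x hx =>
    obtain ⟨s, t, h1, h2, h3, h4, rfl⟩ := hx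
    rw [varW, mono_mul]
    exact Submodule.subset_span ⟨_, _, by omega, by omega, by omega, by omega, rfl⟩

/-- A polynomial of degree less than `n` in `z` is a combination of `1, z, …, z ^ (n - 1)` up to a
multiple of `w`. -/
theorem exists_add_varW_mul {n : ℕ} {k : ℤ} {f : Laurent} (hf : f ∈ pSpace (n - 1) k) :
    ∃ c : Fin n → ℂ, ∃ g ∈ pSpace (n - 1) (k - 1),
      f = ∑ i, c i • mono (i : ℕ) 0 + varW * g := by
  induction hf using Submodule.span_induction with
  | zero => exact ⟨0, 0, zero_mem _, by simp⟩
  | add x y _ _ hx hy =>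
    obtain ⟨c, g, hg, rfl⟩ := hx
    obtain ⟨d, h, hh, rfl⟩ := hy
    refine ⟨c + d, g + h, add_mem hg hh, ?_⟩
    simp only [Pi.add_apply, add_smul, Finset.sum_add_distrib, mul_add]
    abel
  | smul a x _ hx =>
    obtain ⟨c, g, hg, rfl⟩ := hx
    refine ⟨a • c, a • g, Submodule.smul_mem _ _ hg, ?_⟩
    simp only [Pi.smul_apply, smul_eq_mul, mul_smul, smul_add, Finset.smul_sum, mul_smul_comm]
  | mem x hx =>
    obtain ⟨s, t, h1, h2, h3, h4, rfl⟩ := hx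
    rcases h3.eq_or_lt with rfl | h3
    · lift s to ℕ using h1
      refine ⟨Pi.single ⟨s, by omega⟩ 1, 0, zero_mem _, ?_⟩
      rw [Finset.sum_eq_single ⟨s, by omega⟩]
      · simp
      · intro b _ hb
        simp [hb]
      · simp
    · refine ⟨0, mono s (t - 1), Submodule.subset_span
        ⟨s, t - 1, h1, h2, by omega, by omega, rfl⟩, ?_⟩
      simp [varW, mono_mul]

/-- A monomial has modulus one on the torus, so it cancels against its own conjugate reflection. -/
theorem mul_conjInv_mono_mul (s t : ℤ) (f g : Laurent) :
    mono s t * f * conjInv (mono s t * g) = f * conjInv g := by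
  have h : mono s t * conjInv (mono s t) = 1 := by
    rw [conjInv_mono, mono_mul]
    simp only [mono, add_neg_cancel, AddMonoidAlgebra.one_def]
    rfl
  rw [map_mul]
  calc _ = (mono s t * conjInv (mono s t)) * (f * conjInv g) := by ring
    _ = _ := by rw [h, one_mul]

/-! ### Geometry of ℋ -/

section
variable {n m : ℕ} {𝒯 : PositiveForm n m}

theorem incl_injective : Function.Injective (incl 𝒯) := Subtype.val_injective

theorem exists_incl_eq {f : Laurent} (hf : f ∈ pSpace n m) : ∃ x : Hilb 𝒯, incl 𝒯 x = f :=
  ⟨(⟨f, hf⟩ : pSpace n m), rfl⟩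

/-- Multiplication by a monomial is isometric. -/
theorem inner_eq_of_incl_eq_mono_mul (s t : ℤ) {x y x' y' : Hilb 𝒯}
    (hx : incl 𝒯 x' = mono s t * incl 𝒯 x) (hy : incl 𝒯 y' = mono s t * incl 𝒯 y) :
    inner ℂ x' y' = inner ℂ x y := by
  have h : incl 𝒯 y' * conjInv (incl 𝒯 x') = incl 𝒯 y * conjInv (incl 𝒯 x) := by
    rw [hx, hy, mul_conjInv_mono_mul]
  exact congrArg 𝒯.form (Subtype.ext h)

theorem mem_polys {k l : ℤ} {x : Hilb 𝒯} : x ∈ polys 𝒯 k l ↔ incl 𝒯 x ∈ pSpace k l := Iff.rfl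

theorem polys_mono {j k j' k' : ℤ} (hj : j ≤ j') (hk : k ≤ k') :
    polys 𝒯 j k ≤ polys 𝒯 j' k' :=
  Submodule.comap_mono (pSpace_mono hj hk)

theorem mem_polys_self (x : Hilb 𝒯) : x ∈ polys 𝒯 n m := Subtype.prop (p := (· ∈ pSpace n m)) x

theorem mem_mulSub {q : Laurent} {V : Submodule ℂ (Hilb 𝒯)} {x : Hilb 𝒯} :
    x ∈ mulSub q V ↔ ∃ y ∈ V, q * incl 𝒯 y = incl 𝒯 x := by
  simp [mulSub]

theorem exists_incl_eq_varW_mul {x : Hilb 𝒯} {k : ℤ} (hx : x ∈ polys 𝒯 k (m - 1)) (hk : k ≤ n) :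
    ∃ y : Hilb 𝒯, incl 𝒯 y = varW * incl 𝒯 x :=
  exists_incl_eq (pSpace_mono hk le_rfl (varW_mul_mem hx))

theorem exists_add_ominus {V W : Submodule ℂ (Hilb 𝒯)} (h : W ≤ V) {x : Hilb 𝒯} (hx : x ∈ V) :
    ∃ y ∈ W, ∃ z ∈ ominus V W, x = y + z := by
  have : W ⊔ Wᗮ ⊓ V = V := Submodule.sup_orthogonal_inf_of_hasOrthogonalProjection h
  rw [← this] at hx
  obtain ⟨y, hy, z, hz, rfl⟩ := Submodule.mem_sup.1 hx
  exact ⟨y, hy, z, ⟨hz.2, hz.1⟩, rfl⟩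

theorem ominus_sup {V W : Submodule ℂ (Hilb 𝒯)} (h : W ≤ V) : ominus V W ⊔ W = V := by
  rw [ominus, inf_comm, sup_comm]
  exact Submodule.sup_orthogonal_inf_of_hasOrthogonalProjection h

theorem ominus_isOrtho (V W : Submodule ℂ (Hilb 𝒯)) : ominus V W ⟂ W :=
  inf_le_right

/-- A vector orthogonal to one summand of an orthogonal sum lies in the other. -/
theorem mem_of_forall_inner_eq_zero {K L : Submodule ℂ (Hilb 𝒯)} (h : K ⟂ L) {x : Hilb 𝒯}
    (hx : x ∈ K ⊔ L) (hK : ∀ y ∈ K, inner ℂ y x = 0) : x ∈ L := by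
  obtain ⟨y, hy, z, hz, rfl⟩ := Submodule.mem_sup.1 hx
  have h1 := hK y hy
  rw [inner_add_right, Submodule.isOrtho_iff_inner_eq.1 h y hy z hz, add_zero,
    inner_self_eq_zero] at h1
  simpa [h1] using hz

/-! ### Split-shift conditions in terms of A, B and T -/

theorem incl_MzE1 (x : E1 𝒯 (n - 1) m) : incl 𝒯 (MzE1 𝒯 x) = varZ * incl 𝒯 x := rfl

theorem mem_varZ_mulSub {K : Submodule ℂ (Hilb 𝒯)} (hK : K ≤ E1 𝒯 (n - 1) m) {h : Hilb 𝒯} :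
    h ∈ mulSub varZ K ↔ ∃ x : E1 𝒯 (n - 1) m, (x : Hilb 𝒯) ∈ K ∧ MzE1 𝒯 x = h := by
  rw [mem_mulSub]
  constructor
  · rintro ⟨y, hy, hyh⟩
    exact ⟨⟨y, hK hy⟩, hy, incl_injective hyh⟩
  · rintro ⟨x, hx, rfl⟩
    exact ⟨x, hx, rfl⟩

theorem inner_E1_varW_mul {x : Hilb 𝒯} (hx : x ∈ E1 𝒯 (n - 1) m) {p y : Hilb 𝒯}
    (hp : p ∈ polys 𝒯 (n - 1) (m - 1)) (hy : incl 𝒯 y = varW * incl 𝒯 p) : inner ℂ y x = 0 :=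
  (mem_ominus.1 hx).2 y (mem_mulSub.2 ⟨p, hp, hy.symm⟩)

theorem mem_E1_iff_wF2 {x : Hilb 𝒯} (hx : x ∈ E1 𝒯 (n - 1) m) :
    x ∈ E1 𝒯 n m ↔ ∀ f ∈ wF2 𝒯, inner ℂ f x = 0 := by
  constructor
  · intro h f hf
    obtain ⟨p, hp, hpf⟩ := mem_mulSub.1 hf
    exact (mem_ominus.1 h).2 f (mem_mulSub.2 ⟨p, hp.1, hpf⟩)
  · intro h
    refine mem_ominus.2 ⟨mem_polys_self x, fun f hf => ?_⟩
    obtain ⟨p, hp, hpf⟩ := mem_mulSub.1 hf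
    -- 𝒫_{n,m-1} = 𝒫_{n-1,m-1} ⊕ ℱ²_{n,m-1}; after multiplication by w, the first part is orthogonal
    -- to x automatically.
    obtain ⟨p₁, h₁, p₂, h₂, rfl⟩ := exists_add_ominus
      (polys_mono (𝒯 := 𝒯) (sub_le_self (n : ℤ) zero_le_one) le_rfl) hp
    obtain ⟨f₁, hf₁⟩ := exists_incl_eq_varW_mul h₁ (by simp)
    obtain ⟨f₂, hf₂⟩ := exists_incl_eq_varW_mul h₂.1 le_rfl
    obtain rfl : f = f₁ + f₂ := incl_injective (by rw [map_add, hf₁, hf₂, ← hpf, map_add, mul_add])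
    rw [inner_add_left, inner_E1_varW_mul hx h₁ hf₁, h f₂ (mem_mulSub.2 ⟨p₂, h₂, hf₂.symm⟩),
      add_zero]

/-- This uses the splitting 𝒫_{n,m-1} = z𝒫_{n-1,m-1} ⊕ ℰ²_{n,m-1}: the z-multiples impose nothing,
since the common factor z cancels. -/
theorem MzE1_mem_E1_iff_wE2 (x : E1 𝒯 (n - 1) m) :
    MzE1 𝒯 x ∈ E1 𝒯 n m ↔ ∀ f ∈ wE2 𝒯, inner ℂ f (MzE1 𝒯 x) = 0 := by
  constructor
  · intro h f hf
    obtain ⟨p, hp, hpf⟩ := mem_mulSub.1 hf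
    exact (mem_ominus.1 h).2 f (mem_mulSub.2 ⟨p, hp.1, hpf⟩)
  · intro h
    refine mem_ominus.2 ⟨mem_polys_self _, fun f hf => ?_⟩
    obtain ⟨p, hp, hpf⟩ := mem_mulSub.1 hf
    have hle : mulSub varZ (polys 𝒯 (n - 1) (m - 1)) ≤ polys 𝒯 n (m - 1) := by
      intro y hy
      obtain ⟨q, hq, hqy⟩ := mem_mulSub.1 hy
      rw [mem_polys, ← hqy]
      exact varZ_mul_mem hq
    obtain ⟨p₁, h₁, p₂, h₂, rfl⟩ := exists_add_ominus hle hp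
    obtain ⟨f₁, hf₁⟩ := exists_incl_eq_varW_mul (hle h₁) le_rfl
    obtain ⟨f₂, hf₂⟩ := exists_incl_eq_varW_mul h₂.1 le_rfl
    obtain rfl : f = f₁ + f₂ := incl_injective (by rw [map_add, hf₁, hf₂, ← hpf, map_add, mul_add])
    obtain ⟨q, hq, hqp⟩ := mem_mulSub.1 h₁
    obtain ⟨g, hg⟩ := exists_incl_eq_varW_mul hq (by simp)
    -- Here f₁ = zg with g = wq, so removing z from both arguments leaves ⟨g, x⟩.
    have hfg : inner ℂ f₁ (MzE1 𝒯 x) = inner ℂ g (x : Hilb 𝒯) :=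
      inner_eq_of_incl_eq_mono_mul 1 0
        (by rw [hf₁, ← hqp, hg]; exact mul_left_comm _ _ _) (incl_MzE1 x)
    rw [inner_add_left, hfg, inner_E1_varW_mul x.2 hq hg,
      h f₂ (mem_mulSub.2 ⟨p₂, h₂, hf₂.symm⟩), add_zero]

theorem inner_opT (x y : E1 𝒯 (n - 1) m) :
    inner ℂ x (opT 𝒯 y) = inner ℂ (x : Hilb 𝒯) (MzE1 𝒯 y) :=
  Submodule.inner_orthogonalProjectionOnto_eq_of_mem_left x (MzE1 𝒯 y)

theorem inner_opA (f : wE2 𝒯) (y : E1 𝒯 (n - 1) m) :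
    inner ℂ f (opA 𝒯 y) = inner ℂ (f : Hilb 𝒯) (MzE1 𝒯 y) :=
  Submodule.inner_orthogonalProjectionOnto_eq_of_mem_left f (MzE1 𝒯 y)

theorem inner_opB (x : E1 𝒯 (n - 1) m) (f : wF2 𝒯) :
    inner ℂ (opB 𝒯 f : Hilb 𝒯) (x : Hilb 𝒯) = inner ℂ (f : Hilb 𝒯) (x : Hilb 𝒯) :=
  Submodule.inner_orthogonalProjectionOnto_eq_of_mem_right x (f : Hilb 𝒯)

theorem mem_E1_iff_opB (x : E1 𝒯 (n - 1) m) :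
    (x : Hilb 𝒯) ∈ E1 𝒯 n m ↔ ∀ f, inner ℂ (opB 𝒯 f : Hilb 𝒯) (x : Hilb 𝒯) = 0 := by
  simp only [mem_E1_iff_wF2 x.2, inner_opB, Subtype.forall]

theorem MzE1_mem_E1_iff_opA (x : E1 𝒯 (n - 1) m) : MzE1 𝒯 x ∈ E1 𝒯 n m ↔ opA 𝒯 x = 0 := by
  rw [MzE1_mem_E1_iff_wE2]
  constructor
  · intro h
    refine ext_inner_left ℂ fun f => ?_
    rw [inner_opA, inner_zero_right, h f f.2]
  · intro h f hf
    rw [← inner_opA ⟨f, hf⟩, h, inner_zero_right]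

/-- Split-shift pairs correspond to the `T`-invariant subspaces between the range of `B` and the
kernel of `A`. -/
theorem isSplitShift_iff {K₁ K₂ : Submodule ℂ (Hilb 𝒯)} (hsup : K₁ ⊔ K₂ = E1 𝒯 (n - 1) m)
    (hort : K₁ ⟂ K₂) :
    IsSplitShift 𝒯 K₁ K₂ ↔ (∀ f, (opB 𝒯 f : Hilb 𝒯) ∈ K₂) ∧
      ∀ x : E1 𝒯 (n - 1) m, (x : Hilb 𝒯) ∈ K₂ → (opT 𝒯 x : Hilb 𝒯) ∈ K₂ ∧ opA 𝒯 x = 0 := by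
  have h₁ : K₁ ≤ E1 𝒯 (n - 1) m := hsup ▸ le_sup_left
  have h₂ : K₂ ≤ E1 𝒯 (n - 1) m := hsup ▸ le_sup_right
  -- K₂ is exactly the complement of K₁ in ℰ¹_{n-1,m}, so membership in K₂ can be tested against K₁.
  have mem₂ (x : E1 𝒯 (n - 1) m) (hx : ∀ y ∈ K₁, inner ℂ y (x : Hilb 𝒯) = 0) :
      (x : Hilb 𝒯) ∈ K₂ :=
    mem_of_forall_inner_eq_zero hort (by rw [hsup]; exact x.2) hx
  constructor
  · intro h
    refine ⟨fun f => mem₂ _ fun y hy => ?_, fun x hx => ⟨mem₂ _ fun y hy => ?_, ?_⟩⟩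
    · exact inner_eq_zero_symm.1 ((mem_E1_iff_opB ⟨y, h₁ hy⟩).1 (h.left_le hy) f)
    · exact (inner_opT ⟨y, h₁ hy⟩ x).trans (Submodule.isOrtho_iff_inner_eq.1 h.ortho_shift y hy _
        ((mem_varZ_mulSub h₂).2 ⟨x, hx, rfl⟩))
    · exact (MzE1_mem_E1_iff_opA x).1 (h.shift_le ((mem_varZ_mulSub h₂).2 ⟨x, hx, rfl⟩))
  · rintro ⟨hB, hTA⟩
    refine ⟨hsup, hort, ?_, ?_, ?_⟩
    · refine Submodule.isOrtho_iff_inner_eq.2 fun y hy v hv => ?_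
      obtain ⟨x, hx, rfl⟩ := (mem_varZ_mulSub h₂).1 hv
      rw [← inner_opT ⟨y, h₁ hy⟩ x]
      exact Submodule.isOrtho_iff_inner_eq.1 hort y hy _ (hTA x hx).1
    · intro y hy
      refine (mem_E1_iff_opB ⟨y, h₁ hy⟩).2 fun f => inner_eq_zero_symm.1 ?_
      exact Submodule.isOrtho_iff_inner_eq.1 hort y hy _ (hB f)
    · intro v hv
      obtain ⟨x, hx, rfl⟩ := (mem_varZ_mulSub h₂).1 hv
      exact (MzE1_mem_E1_iff_opA x).2 (hTA x hx).2

/-! ### Dimension bound and Cayley–Hamilton -/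

/-- `ℰ¹_{n-1,m}` is spanned by the projections of `1, z, …, z ^ (n - 1)`. -/
theorem finrank_E1_le : Module.finrank ℂ (E1 𝒯 (n - 1) m) ≤ n := by
  have hz (i : Fin n) : ∃ x : Hilb 𝒯, incl 𝒯 x = mono (i : ℕ) 0 :=
    exists_incl_eq (Submodule.subset_span
      ⟨_, _, by omega, by have := i.2; omega, le_rfl, by omega, rfl⟩)
  choose e he using hz
  let P := (E1 𝒯 (n - 1) m).orthogonalProjectionOnto
  have htop : (⊤ : Submodule ℂ (E1 𝒯 (n - 1) m)) ≤ Submodule.span ℂ (Set.range (P ∘ e)) := by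
    rintro x -
    obtain ⟨c, g, hg, hx⟩ := exists_add_varW_mul (mem_polys.1 (mem_ominus.1 x.2).1)
    obtain ⟨p, rfl⟩ := exists_incl_eq (𝒯 := 𝒯) (pSpace_mono (by simp) (by simp) hg)
    obtain ⟨y, hy⟩ := exists_incl_eq_varW_mul (mem_polys.2 hg) (by simp)
    have hxy : (x : Hilb 𝒯) = ∑ i, c i • e i + y := incl_injective (by
      simp only [hx, map_add, map_sum, map_smul, he, hy])
    -- The multiple of w is orthogonal to ℰ¹_{n-1,m}, so only the projections of the powers of z
    -- survive.
    have hPy : P y = 0 := by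
      refine Submodule.orthogonalProjectionOnto_eq_zero_iff.2 ?_
      exact (Submodule.mem_orthogonal' _ _).2 fun u hu => inner_E1_varW_mul hu hg hy
    have hPx : P x = x := Submodule.orthogonalProjectionOnto_mem_subspace_eq_self x
    rw [← hPx, hxy, map_add, hPy, add_zero, map_sum]
    refine Submodule.sum_mem _ fun i _ => ?_
    rw [map_smul]
    exact Submodule.smul_mem _ _ (Submodule.subset_span ⟨i, rfl⟩)
  calc Module.finrank ℂ (E1 𝒯 (n - 1) m)
      = Module.finrank ℂ (⊤ : Submodule ℂ (E1 𝒯 (n - 1) m)) := (finrank_top ℂ _).symm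
    _ ≤ Module.finrank ℂ (Submodule.span ℂ (Set.range (P ∘ e))) := Submodule.finrank_mono htop
    _ ≤ Fintype.card (Fin n) := finrank_range_le_card (P ∘ e)
    _ = n := Fintype.card_fin n

end

/-- By the Cayley–Hamilton theorem, the powers of an endomorphism of a space of dimension at most
`d` are combinations of the first `d` of them. -/
theorem pow_mem_span_pow_lt {V : Type*} [AddCommGroup V] [Module ℂ V] [FiniteDimensional ℂ V]
    (T : Module.End ℂ V) {d : ℕ} (hd : Module.finrank ℂ V ≤ d) (k : ℕ) :
    T ^ k ∈ Submodule.span ℂ {S | ∃ j < d, S = T ^ j} := by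
  rw [LinearMap.pow_eq_aeval_mod_charpoly, Polynomial.aeval_eq_sum_range]
  set r := Polynomial.X ^ k %ₘ T.charpoly with hr
  refine Submodule.sum_mem _ fun i _ => ?_
  by_cases hi : r.coeff i = 0
  · rw [hi, zero_smul]
    exact zero_mem _
  · refine Submodule.smul_mem _ _ (Submodule.subset_span ⟨i, ?_, rfl⟩)
    -- An exponent occurring in the remainder is below the degree of the characteristic polynomial,
    -- which is dim V ≤ d.
    have h1 : (i : WithBot ℕ) ≤ r.degree := Polynomial.le_degree_of_ne_zero hi
    have h2 : r.degree < T.charpoly.degree := Polynomial.degree_modByMonic_lt _ T.charpoly_monic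
    rw [Polynomial.degree_eq_natDegree T.charpoly_monic.ne_zero, LinearMap.charpoly_natDegree]
      at h2
    exact (WithBot.coe_lt_coe.1 (h1.trans_lt h2)).trans_le hd

/-! ### The two extremal pairs -/

section
variable {n m : ℕ} {𝒯 : PositiveForm n m}

theorem MatrixCondition.opA_pow_opB (h : MatrixCondition 𝒯) (j : ℕ) (f : wF2 𝒯) :
    opA 𝒯 ((opT 𝒯 ^ j) (opB 𝒯 f)) = 0 := by
  have key : ∀ S ∈ Submodule.span ℂ {S | ∃ j < n, S = opT 𝒯 ^ j}, opA 𝒯 (S (opB 𝒯 f)) = 0 := by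
    intro S hS
    induction hS using Submodule.span_induction with
    | zero => simp
    | add x y _ _ hx hy => simp [hx, hy]
    | smul c x _ hx => simp [hx]
    | mem x hx =>
      obtain ⟨j, hj, rfl⟩ := hx
      exact LinearMap.congr_fun (h j hj) f
  exact key _ (pow_mem_span_pow_lt _ finrank_E1_le j)

theorem spaceB_le_E1 : spaceB 𝒯 ≤ E1 𝒯 (n - 1) m := by
  refine Submodule.span_le.2 ?_
  rintro _ ⟨j, f, rfl⟩
  exact Subtype.prop _

theorem spaceA_le_E1 : spaceA 𝒯 ≤ E1 𝒯 (n - 1) m := by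
  refine Submodule.span_le.2 ?_
  rintro _ ⟨j, f, rfl⟩
  exact Subtype.prop _

theorem inner_adjoint_pow_adjoint (j : ℕ) (f : wE2 𝒯) (x : E1 𝒯 (n - 1) m) :
    inner ℂ ((LinearMap.adjoint (opT 𝒯) ^ j) (LinearMap.adjoint (opA 𝒯) f)) x =
      inner ℂ f (opA 𝒯 ((opT 𝒯 ^ j) x)) := by
  induction j generalizing x with
  | zero => simp [LinearMap.adjoint_inner_left]
  | succ j ih =>
    rw [pow_succ', Module.End.mul_apply, LinearMap.adjoint_inner_left, ih, pow_succ,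
      Module.End.mul_apply]

/-- Within `ℰ¹_{n-1,m}`, the complement of `𝓐` is the largest `T`-invariant subspace of the kernel
of `A`. -/
theorem mem_ominus_spaceA_iff (x : E1 𝒯 (n - 1) m) :
    (x : Hilb 𝒯) ∈ ominus (E1 𝒯 (n - 1) m) (spaceA 𝒯) ↔
      ∀ j : ℕ, opA 𝒯 ((opT 𝒯 ^ j) x) = 0 := by
  rw [mem_ominus]
  constructor
  · rintro ⟨-, h⟩ j
    refine ext_inner_left ℂ fun f => ?_
    rw [inner_zero_right, ← inner_adjoint_pow_adjoint]
    exact h _ (Submodule.subset_span ⟨j, f, rfl⟩)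
  · intro h
    refine ⟨x.2, fun y hy => ?_⟩
    induction hy using Submodule.span_induction with
    | zero => simp
    | add u v _ _ hu hv => rw [inner_add_left, hu, hv, add_zero]
    | smul c u _ hu => rw [inner_smul_left, hu, mul_zero]
    | mem u hu =>
      obtain ⟨j, f, rfl⟩ := hu
      exact (inner_adjoint_pow_adjoint j f x).trans (by rw [h j, inner_zero_right])

theorem MatrixCondition.isSplitShift_spaceB (h : MatrixCondition 𝒯) :
    IsSplitShift 𝒯 (ominus (E1 𝒯 (n - 1) m) (spaceB 𝒯)) (spaceB 𝒯) := by
  rw [isSplitShift_iff (ominus_sup spaceB_le_E1) (ominus_isOrtho _ _)]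
  refine ⟨fun f => Submodule.subset_span ⟨0, f, rfl⟩, fun x hx => ?_⟩
  -- The span lives in ℋ while T and A act only on ℰ¹_{n-1,m}; carrying the membership proof through
  -- the induction keeps them applicable.
  suffices H : ∀ y ∈ spaceB 𝒯, ∃ hy : y ∈ E1 𝒯 (n - 1) m,
      (opT 𝒯 ⟨y, hy⟩ : Hilb 𝒯) ∈ spaceB 𝒯 ∧ opA 𝒯 ⟨y, hy⟩ = 0 from (H x hx).2
  intro y hy
  induction hy using Submodule.span_induction with
  | zero =>
    have e : (⟨0, zero_mem _⟩ : E1 𝒯 (n - 1) m) = 0 := rfl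
    refine ⟨zero_mem _, ?_, ?_⟩
    · rw [e, map_zero]; exact zero_mem _
    · rw [e, map_zero]
  | add u v _ _ hu hv =>
    obtain ⟨hu, hu₁, hu₂⟩ := hu
    obtain ⟨hv, hv₁, hv₂⟩ := hv
    have e : (⟨u + v, add_mem hu hv⟩ : E1 𝒯 (n - 1) m) = ⟨u, hu⟩ + ⟨v, hv⟩ := rfl
    refine ⟨add_mem hu hv, ?_, ?_⟩
    · rw [e, map_add]; exact add_mem hu₁ hv₁
    · rw [e, map_add, hu₂, hv₂, add_zero]
  | smul c u _ hu =>
    obtain ⟨hu, hu₁, hu₂⟩ := hu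
    have e : (⟨c • u, Submodule.smul_mem _ c hu⟩ : E1 𝒯 (n - 1) m) = c • ⟨u, hu⟩ := rfl
    refine ⟨Submodule.smul_mem _ c hu, ?_, ?_⟩
    · rw [e, map_smul]; exact Submodule.smul_mem _ c hu₁
    · rw [e, map_smul, hu₂, smul_zero]
  | mem u hu =>
    obtain ⟨j, f, rfl⟩ := hu
    refine ⟨Subtype.prop _, Submodule.subset_span ⟨j + 1, f, ?_⟩, h.opA_pow_opB j f⟩
    rw [pow_succ', Module.End.mul_apply]

theorem MatrixCondition.isSplitShift_spaceA (h : MatrixCondition 𝒯) :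
    IsSplitShift 𝒯 (spaceA 𝒯) (ominus (E1 𝒯 (n - 1) m) (spaceA 𝒯)) := by
  rw [isSplitShift_iff (by rw [sup_comm]; exact ominus_sup spaceA_le_E1) (ominus_isOrtho _ _).symm]
  -- ran B lies in the complement of 𝓐 precisely because AT^jB = 0 for every j.
  refine ⟨fun f => (mem_ominus_spaceA_iff _).2 fun j => h.opA_pow_opB j f, fun x hx => ?_⟩
  rw [mem_ominus_spaceA_iff] at hx ⊢
  refine ⟨fun j => ?_, hx 0⟩
  rw [← Module.End.mul_apply, ← pow_succ]
  exact hx (j + 1)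

theorem IsSplitShift.pow_opT_mem {K₁ K₂ : Submodule ℂ (Hilb 𝒯)} (h : IsSplitShift 𝒯 K₁ K₂)
    {x : E1 𝒯 (n - 1) m} (hx : (x : Hilb 𝒯) ∈ K₂) (j : ℕ) :
    ((opT 𝒯 ^ j) x : Hilb 𝒯) ∈ K₂ := by
  induction j with
  | zero => exact hx
  | succ j ih =>
    rw [pow_succ', Module.End.mul_apply]
    exact (((isSplitShift_iff h.sup_eq h.ortho).1 h).2 _ ih).1

theorem IsSplitShift.spaceB_le {K₁ K₂ : Submodule ℂ (Hilb 𝒯)} (h : IsSplitShift 𝒯 K₁ K₂) :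
    spaceB 𝒯 ≤ K₂ := by
  refine Submodule.span_le.2 ?_
  rintro _ ⟨j, f, rfl⟩
  exact h.pow_opT_mem (((isSplitShift_iff h.sup_eq h.ortho).1 h).1 f) j

theorem IsSplitShift.spaceA_le {K₁ K₂ : Submodule ℂ (Hilb 𝒯)} (h : IsSplitShift 𝒯 K₁ K₂) :
    spaceA 𝒯 ≤ K₁ := by
  intro y hy
  -- It suffices that 𝓐 ⟂ K₂, which holds since T^j maps K₂ into K₂ ⊂ ker A.
  refine mem_of_forall_inner_eq_zero h.ortho.symm
    (by rw [sup_comm, h.sup_eq]; exact spaceA_le_E1 hy) fun x hx => ?_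
  have hxX : x ∈ E1 𝒯 (n - 1) m := h.sup_eq ▸ Submodule.mem_sup_right hx
  refine inner_eq_zero_symm.1 ((mem_ominus.1 ((mem_ominus_spaceA_iff ⟨x, hxX⟩).2 fun j => ?_)).2 y hy)
  exact (((isSplitShift_iff h.sup_eq h.ortho).1 h).2 _ (h.pow_opT_mem (x := ⟨x, hxX⟩) hx j)).2

end

end SplitShift

end

theorem mainTheorem4 (n m : ℕ) (𝒯 : SplitShift.PositiveForm n m)
    (hmc : SplitShift.MatrixCondition 𝒯) :
    SplitShift.IsSplitShift 𝒯
      (SplitShift.ominus (SplitShift.E1 𝒯 (n - 1) m) (SplitShift.spaceB 𝒯))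
      (SplitShift.spaceB 𝒯) ∧
    SplitShift.IsSplitShift 𝒯
      (SplitShift.spaceA 𝒯)
      (SplitShift.ominus (SplitShift.E1 𝒯 (n - 1) m) (SplitShift.spaceA 𝒯)) ∧
    ∀ K₁' K₂' : Submodule ℂ (SplitShift.Hilb 𝒯), SplitShift.IsSplitShift 𝒯 K₁' K₂' →
      SplitShift.spaceA 𝒯 ≤ K₁' ∧ SplitShift.spaceB 𝒯 ≤ K₂' := by
  exact ⟨hmc.isSplitShift_spaceB, hmc.isSplitShift_spaceA,
    fun _ _ h => ⟨h.spaceA_le, h.spaceB_le⟩⟩
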